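/- Let some points of the plane $\mathbb{C}$ be called "good" and some others "bad", no point being both. Suppose that the open unit disc $|z|<1$ contains exactly $g$ good points and that the open disc $|z|<3$ contains exactly $b$ bad points, where $g \ge 1$ and $b \ge 0$ are integers. Then there is an open disc of positive radius in the plane that contains more than $g/(2b+12)$ good points and no bad points. -/

import Mathlib

open scoped ENNReal

/-! Let P be the bad points in |z| < 3 together with a hexagon's vertices. As in a Delaunay
triangulation, each good z in the unit disc lies in a P-free open disc with three points of P on its
circle (`exists_empty_circumdisc`). The hexagon keeps that disc inside |z| < 3, so it contains no
bad point at all. Order P by a generic linear functional. The disc is determined by a middle point v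
on its circle and the side of v on which the chord lies (`IsMiddleVertex.unique`). As v is never the
minimum of P, at most 2(b + 5) discs occur, and pigeonhole on the good points finishes. -/

/-- The power of `z` with respect to the circle with centre `c` and squared radius `R`. -/
def circlePower (c : ℂ) (R : ℝ) (z : ℂ) : ℝ := (z.re - c.re) ^ 2 + (z.im - c.im) ^ 2 - R

theorem dist_sq_eq_circlePower (c : ℂ) (R : ℝ) (z : ℂ) : dist z c ^ 2 = circlePower c R z + R := by
  rw [Complex.dist_eq, Complex.sq_norm, Complex.normSq_apply]
  simp [circlePower]
  ring

theorem mem_ball_sqrt_iff (c : ℂ) (R : ℝ) (z : ℂ) :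
    z ∈ Metric.ball c (√R) ↔ circlePower c R z < 0 := by
  rw [Metric.mem_ball, Real.lt_sqrt dist_nonneg, dist_sq_eq_circlePower c R]
  constructor <;> intro h <;> linarith

/-! ### The hexagon confines the discs -/

/-- The vertices of a regular hexagon inscribed in the circle of radius `√3`. -/
noncomputable def hexagon : Finset ℂ :=
  {⟨√3, 0⟩, ⟨-√3, 0⟩, ⟨√3 / 2, 3 / 2⟩, ⟨√3 / 2, -3 / 2⟩, ⟨-√3 / 2, 3 / 2⟩, ⟨-√3 / 2, -3 / 2⟩}

theorem sqrt_three_sq : √(3 : ℝ) ^ 2 = 3 := Real.sq_sqrt (by norm_num)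

theorem normSq_of_mem_hexagon {p : ℂ} (hp : p ∈ hexagon) : p.re ^ 2 + p.im ^ 2 = 3 := by
  have h3 := sqrt_three_sq
  simp only [hexagon, Finset.mem_insert, Finset.mem_singleton] at hp
  rcases hp with rfl | rfl | rfl | rfl | rfl | rfl <;> simp only <;> linarith

/-- Some vertex makes an angle of at most 30° with c, and √3 · cos 30° = 3/2. -/
theorem exists_mem_hexagon_inner_ge (c : ℂ) :
    ∃ p ∈ hexagon, 3 / 2 * ‖c‖ ≤ p.re * c.re + p.im * c.im := by
  have h3 := sqrt_three_sq
  have h0 : 0 < √(3 : ℝ) := by positivity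
  have key : 3 / 2 * ‖c‖ ≤ √3 * |c.re| ∨ 3 / 2 * ‖c‖ ≤ √3 / 2 * |c.re| + 3 / 2 * |c.im| := by
    have hc : ‖c‖ ^ 2 = |c.re| ^ 2 + |c.im| ^ 2 := by
      rw [Complex.sq_norm, Complex.normSq_apply, sq_abs, sq_abs]; ring
    have hx := abs_nonneg c.re
    have hy := abs_nonneg c.im
    generalize |c.re| = x at *
    generalize |c.im| = y at *
    rcases le_total (√3 * y) x with h | h
    · left
      apply le_of_sq_le_sq _ (by positivity)
      have : (√3 * y) ^ 2 ≤ x ^ 2 := by gcongr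
      rw [mul_pow, h3] at this
      rw [mul_pow, mul_pow, h3, hc]
      linarith
    · right
      apply le_of_sq_le_sq _ (by positivity)
      have : x * x ≤ x * (√3 * y) := by gcongr
      have e : (√3 / 2 * x + 3 / 2 * y) ^ 2
        = √3 ^ 2 / 4 * x ^ 2 + 9 / 4 * y ^ 2 + 3 / 2 * (x * (√3 * y)) := by ring
      rw [mul_pow, e, h3, hc]
      linarith
  rcases key with h | h
  · rcases abs_cases c.re with ⟨h', -⟩ | ⟨h', -⟩ <;> rw [h'] at h
    · exact ⟨⟨√3, 0⟩, by simp [hexagon], by simpa using h⟩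
    · exact ⟨⟨-√3, 0⟩, by simp [hexagon], by simpa using h⟩
  · rcases abs_cases c.re with ⟨h', -⟩ | ⟨h', -⟩ <;>
      rcases abs_cases c.im with ⟨h'', -⟩ | ⟨h'', -⟩ <;> rw [h', h''] at h
    · exact ⟨⟨√3 / 2, 3 / 2⟩, by simp [hexagon], by simp only; linarith⟩
    · exact ⟨⟨√3 / 2, -3 / 2⟩, by simp [hexagon], by simp only; linarith⟩
    · exact ⟨⟨-√3 / 2, 3 / 2⟩, by simp [hexagon], by simp only; linarith⟩
    · exact ⟨⟨-√3 / 2, -3 / 2⟩, by simp [hexagon], by simp only; linarith⟩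

/-- A disc that meets the open unit disc and contains no vertex of the hexagon has its centre
within `2` of the origin and lies in the disc of radius `3`. -/
theorem circle_bounds_of_hexagon {c z : ℂ} {R : ℝ} (hP : ∀ p ∈ hexagon, 0 ≤ circlePower c R p)
    (hz : ‖z‖ < 1) (hzc : circlePower c R z ≤ 0) : ‖c‖ ≤ 2 ∧ 0 ≤ R ∧ ‖c‖ + √R ≤ 3 := by
  obtain ⟨p, hp, hpc⟩ := exists_mem_hexagon_inner_ge c
  have hR : 0 ≤ R := by
    unfold circlePower at hzc
    nlinarith [sq_nonneg (z.re - c.re), sq_nonneg (z.im - c.im)]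
  have hc : ‖c‖ ^ 2 = c.re ^ 2 + c.im ^ 2 := by
    rw [Complex.sq_norm, Complex.normSq_apply]; ring
  -- The vertex p nearest in direction to c is not inside the disc: R ≤ |p - c|².
  have h1 : R ≤ 3 - 3 * ‖c‖ + ‖c‖ ^ 2 := by
    have := hP p hp
    have := normSq_of_mem_hexagon hp
    unfold circlePower at *
    nlinarith
  have hd : dist z c ≤ √R := by
    apply Real.le_sqrt_of_sq_le
    rw [dist_sq_eq_circlePower c R]; linarith
  have h2 : ‖c‖ - 1 ≤ √R := by
    have := norm_sub_norm_le c z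
    rw [← dist_eq_norm, dist_comm] at this
    linarith
  have hs := Real.sq_sqrt hR
  have hs0 := Real.sqrt_nonneg R
  -- Compare (‖c‖ - 1)² ≤ R with `h1`.
  have h3 : ‖c‖ ≤ 2 := by
    by_contra! h
    nlinarith
  refine ⟨h3, hR, ?_⟩
  have : √R ≤ 3 - ‖c‖ := by
    apply le_of_sq_le_sq _ (by linarith)
    rw [hs]; nlinarith
  linarith

/-! ### Empty circumdiscs by linear programming -/

/-- Two linear equations on a space of real dimension 3; for two points, u is the direction of the
pencil of circles through them. -/
theorem exists_ne_zero_orthogonal (S : Finset ℂ) (hS : S.card ≤ 2) :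
    ∃ u : ℂ × ℝ, u ≠ 0 ∧ ∀ p ∈ S, u.2 + 2 * (p.re * u.1.re + p.im * u.1.im) = 0 := by
  rcases Nat.lt_or_ge S.card 2 with h | h
  · obtain ⟨a, ha⟩ : ∃ a : ℂ, S ⊆ {a} := Finset.card_le_one_iff_subset_singleton.mp (by omega)
    refine ⟨(1, -2 * a.re), by simp, fun p hp => ?_⟩
    obtain rfl := Finset.mem_singleton.mp (ha hp)
    simp
  · obtain ⟨a, b, hab, rfl⟩ := Finset.card_eq_two.mp (le_antisymm hS h)
    refine ⟨(⟨a.im - b.im, b.re - a.re⟩, -2 * (a.re * (a.im - b.im) + a.im * (b.re - a.re))),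
      fun h0 => hab ?_, fun p hp => ?_⟩
    · have h1 := congrArg Prod.fst h0
      have hr := congrArg Complex.re h1
      have hi := congrArg Complex.im h1
      simp only [Prod.fst_zero, Complex.zero_re, Complex.zero_im] at hr hi
      apply Complex.ext <;> linarith
    · simp only [Finset.mem_insert, Finset.mem_singleton] at hp
      rcases hp with rfl | rfl <;> simp only <;> ring

/-- Every point of the open unit disc outside `P` lies in an open disc that contains no point of
`P` but has at least three points of `P` on its boundary. -/
theorem exists_empty_circumdisc {P : Finset ℂ} (hP : hexagon ⊆ P) {z : ℂ} (hz : ‖z‖ < 1)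
    (hzP : z ∉ P) : ∃ (c : ℂ) (R : ℝ), circlePower c R z < 0 ∧ (∀ p ∈ P, 0 ≤ circlePower c R p) ∧
      2 < {p ∈ P | circlePower c R p = 0}.card := by
  classical
  -- In the coordinates x = (c, R - |c|²) the power of p is `n p - l p x`, affine in x, so emptiness
  -- is a system of linear inequalities.
  let l : ℂ → ℂ × ℝ → ℝ := fun p x => x.2 + 2 * (p.re * x.1.re + p.im * x.1.im)
  let n : ℂ → ℝ := fun p => p.re ^ 2 + p.im ^ 2
  have hl : ∀ p x, circlePower x.1 (x.2 + n x.1) p = n p - l p x := by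
    intro p x; simp only [circlePower, l, n]; ring
  have hcont : ∀ p, Continuous (l p) := by intro p; fun_prop
  have hadd : ∀ p (x u : ℂ × ℝ) (e : ℝ), l p (x + e • u) = l p x + e * l p u := by
    intro p x u e
    simp [l]
    ring
  let K : ℝ → Set (ℂ × ℝ) := fun m => {x | (∀ p ∈ P, l p x ≤ n p) ∧ n z + m ≤ l z x}
  have hclosed : ∀ m, IsClosed (K m) := by
    intro m
    have : K m = (⋂ p ∈ P, {x | l p x ≤ n p}) ∩ {x | n z + m ≤ l z x} := by
      ext x; simp [K]
    rw [this]
    exact (isClosed_biInter fun p _ => isClosed_le (hcont p) continuous_const).inter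
      (isClosed_le continuous_const (hcont z))
  have hcompact : ∀ m, 0 < m → IsCompact (K m) := by
    intro m hm
    refine ((isCompact_closedBall (0 : ℂ) 2).prod (isCompact_Icc (a := (-4 : ℝ)) (b := 9))).of_isClosed_subset
      (hclosed m) ?_
    rintro x ⟨hx, hxz⟩
    have := circle_bounds_of_hexagon (c := x.1) (R := x.2 + n x.1) (z := z)
      (fun p hp => by rw [hl]; linarith [hx p (hP hp)]) hz (by rw [hl]; linarith)
    obtain ⟨h1, h2, h3⟩ := this
    have hn : n x.1 = ‖x.1‖ ^ 2 := by
      rw [Complex.sq_norm, Complex.normSq_apply]; simp only [n]; ring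
    have h0 := norm_nonneg x.1
    have hs := Real.sq_sqrt h2
    have hs0 := Real.sqrt_nonneg (x.2 + n x.1)
    refine ⟨by simpa using h1, ?_, ?_⟩ <;> nlinarith
  -- A small circle centred at z is feasible.
  obtain ⟨δ, hδ, hδP⟩ : ∃ δ > 0, (z, δ - n z) ∈ K δ := by
    have hev : ∀ᶠ δ in nhdsWithin (0 : ℝ) (Set.Ioi 0), ∀ p ∈ P, δ < (p.re - z.re) ^ 2 + (p.im - z.im) ^ 2 := by
      rw [Filter.eventually_all_finset]
      intro p hp
      have hne : 0 < (p.re - z.re) ^ 2 + (p.im - z.im) ^ 2 := by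
        have : 0 < Complex.normSq (p - z) := by
          rw [Complex.normSq_pos, sub_ne_zero]; rintro rfl; exact hzP hp
        rw [Complex.normSq_apply] at this
        simp at this
        linarith
      exact nhdsWithin_le_nhds (eventually_lt_nhds hne)
    obtain ⟨δ, h1, h2⟩ := (hev.and self_mem_nhdsWithin).exists
    refine ⟨δ, h2, fun p hp => ?_, ?_⟩
    · have := h1 p hp
      simp only [l, n]; linarith
    · simp only [l, n]; linarith
  obtain ⟨x₀, hx₀, hmax⟩ := (hcompact δ hδ).exists_isMaxOn ⟨_, hδP⟩ (hcont z).continuousOn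
  set M := l z x₀ - n z with hM
  have hδM : δ ≤ M := by linarith [hx₀.2]
  -- `K M` is the optimal face. At an extreme point of it, at most two active constraints would
  -- leave a direction u with both x ± e • u feasible; optimality forces `l z u = 0`, so both stay
  -- in the face, a contradiction.
  obtain ⟨x, hx⟩ := (hcompact M (hδ.trans_le hδM)).extremePoints_nonempty
    ⟨x₀, hx₀.1, by linarith⟩
  obtain ⟨⟨hxP, hxz⟩, hext⟩ := hx
  refine ⟨x.1, x.2 + n x.1, by rw [hl]; linarith, fun p hp => by rw [hl]; linarith [hxP p hp], ?_⟩
  by_contra! hcard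
  obtain ⟨u, hu0, hu⟩ := exists_ne_zero_orthogonal _ hcard
  have hfeas : ∀ᶠ e in nhds (0 : ℝ), ∀ p ∈ P, l p (x + e • u) ≤ n p := by
    rw [Filter.eventually_all_finset]
    intro p hp
    by_cases hact : l p x = n p
    · have : l p u = 0 := hu p (by simp [hp, hl, hact])
      exact Filter.Eventually.of_forall fun e => by rw [hadd, this, hact]; simp
    · have hlt := lt_of_le_of_ne (hxP p hp) hact
      have : Filter.Tendsto (fun e : ℝ => l p x + e * l p u) (nhds 0) (nhds (l p x + 0 * l p u)) :=
        Continuous.tendsto (by fun_prop) 0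
      rw [zero_mul, add_zero] at this
      filter_upwards [this.eventually_lt_const hlt] with e he
      rw [hadd]; exact he.le
  have hneg : ∀ᶠ e in nhds (0 : ℝ), ∀ p ∈ P, l p (x + (-e) • u) ≤ n p := by
    have : Filter.Tendsto (fun e : ℝ => -e) (nhds 0) (nhds 0) := by
      simpa using (continuous_neg (G := ℝ)).tendsto 0
    exact this.eventually hfeas
  obtain ⟨e, ⟨he1, he2⟩, he0⟩ := (((hfeas.and hneg).filter_mono nhdsWithin_le_nhds).and
    (self_mem_nhdsWithin : Set.Ioi (0 : ℝ) ∈ nhdsWithin 0 (Set.Ioi 0))).exists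
  replace he0 : 0 < e := he0
  have hopt : ∀ e' : ℝ, (∀ p ∈ P, l p (x + e' • u) ≤ n p) → e' * l z u ≤ 0 := by
    intro e' he'
    by_contra! hpos
    have hmem : x + e' • u ∈ K δ := ⟨he', by rw [hadd]; linarith⟩
    have := hmax hmem
    simp only [Set.mem_ofPred_eq, hadd] at this
    linarith
  have hz1 := hopt e he1
  have hz2 := hopt (-e) he2
  have h1 : x + e • u ∈ K M := ⟨he1, by rw [hadd]; linarith⟩
  have h2 : x + (-e) • u ∈ K M := ⟨he2, by rw [hadd]; linarith⟩
  have hseg : x ∈ openSegment ℝ (x + e • u) (x + (-e) • u) := by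
    refine ⟨1 / 2, 1 / 2, by norm_num, by norm_num, by norm_num, ?_⟩
    module
  have := hext h1 h2 hseg
  simp [he0.ne', hu0] at this

/-! ### Middle vertices -/

theorem exists_injOn_re_add_mul_im (P : Finset ℂ) :
    ∃ t : ℝ, Set.InjOn (fun z : ℂ => z.re + t * z.im) P := by
  classical
  obtain ⟨t, ht⟩ := Infinite.exists_notMem_finset
    ((P ×ˢ P).image fun q => -(q.1.re - q.2.re) / (q.1.im - q.2.im))
  refine ⟨t, fun p hp q hq h => ?_⟩
  simp only at h
  by_cases him : p.im = q.im
  · rw [him] at h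
    exact Complex.ext (by linarith) him
  · refine absurd (Finset.mem_image.mpr ⟨(p, q), Finset.mem_product.mpr ⟨hp, hq⟩, ?_⟩) ht
    have : p.im - q.im ≠ 0 := sub_ne_zero.mpr him
    simp only
    field_simp
    linarith

theorem exists_lt_lt_of_two_lt_card {S : Finset ℂ} {f : ℂ → ℝ} (hf : Set.InjOn f S)
    (hS : 2 < S.card) : ∃ a ∈ S, ∃ v ∈ S, ∃ b ∈ S, f a < f v ∧ f v < f b := by
  obtain ⟨a, ha, b, hb, c, hc, hab, hac, hbc⟩ := Finset.two_lt_card.mp hS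
  have h1 := hf.ne ha hb hab
  have h2 := hf.ne ha hc hac
  have h3 := hf.ne hb hc hbc
  rcases lt_or_gt_of_ne h1 with h1 | h1 <;> rcases lt_or_gt_of_ne h2 with h2 | h2 <;>
    rcases lt_or_gt_of_ne h3 with h3 | h3
  · exact ⟨a, ha, b, hb, c, hc, h1, h3⟩
  · exact ⟨a, ha, c, hc, b, hb, h2, h3⟩
  · linarith
  · exact ⟨c, hc, a, ha, b, hb, h2, h1⟩
  · exact ⟨b, hb, a, ha, c, hc, h1, h2⟩
  · linarith
  · exact ⟨b, hb, c, hc, a, ha, h3, h2⟩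
  · exact ⟨c, hc, b, hb, a, ha, h3, h1⟩

/-- `v` lies on the circle, between two other points of `P` on the circle as measured by
`z ↦ z.re + t * z.im`; moving from `v` by `τ` along the kernel of this functional one arrives at the
chord of these two points. -/
def IsMiddleVertex (P : Finset ℂ) (t : ℝ) (c : ℂ) (R : ℝ) (v : ℂ) (τ : ℝ) : Prop :=
  circlePower c R v = 0 ∧ ∃ a ∈ P, ∃ b ∈ P, ∃ s : ℝ, circlePower c R a = 0 ∧
    circlePower c R b = 0 ∧ 0 < s ∧ s < 1 ∧ a.re + t * a.im < v.re + t * v.im ∧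
    (1 - s) * a.re + s * b.re = v.re - t * τ ∧ (1 - s) * a.im + s * b.im = v.im + τ

theorem exists_isMiddleVertex {P : Finset ℂ} {t : ℝ}
    (ht : Set.InjOn (fun z : ℂ => z.re + t * z.im) P) {c : ℂ} {R : ℝ}
    (hcard : 2 < {p ∈ P | circlePower c R p = 0}.card) :
    ∃ v ∈ P, ∃ τ : ℝ, τ ≠ 0 ∧ IsMiddleVertex P t c R v τ := by
  obtain ⟨a, ha, v, hv, b, hb, (h1 : a.re + t * a.im < v.re + t * v.im),
      (h2 : v.re + t * v.im < b.re + t * b.im)⟩ :=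
    exists_lt_lt_of_two_lt_card (ht.mono (Finset.coe_subset.mpr (Finset.filter_subset _ P))) hcard
  rw [Finset.mem_filter] at ha hv hb
  have hD : 0 < (b.re + t * b.im) - (a.re + t * a.im) := by linarith
  set s := ((v.re + t * v.im) - (a.re + t * a.im)) / ((b.re + t * b.im) - (a.re + t * a.im)) with hs
  have hs0 : 0 < s := div_pos (by linarith) hD
  have hs1 : s < 1 := (div_lt_one hD).mpr (by linarith)
  have hsD : s * ((b.re + t * b.im) - (a.re + t * a.im)) = (v.re + t * v.im) - (a.re + t * a.im) :=
    div_mul_cancel₀ _ hD.ne'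
  have him : (1 - s) * a.im + s * b.im = v.im + ((1 - s) * a.im + s * b.im - v.im) := by ring
  have hre : (1 - s) * a.re + s * b.re = v.re - t * ((1 - s) * a.im + s * b.im - v.im) := by
    linarith
  refine ⟨v, hv.1, (1 - s) * a.im + s * b.im - v.im, fun h0 => ?_, hv.2, a, ha.1, b, hb.1, s, ha.2, hb.2, hs0, hs1,
    h1, hre, him⟩
  -- If τ = 0, v would lie strictly inside a chord of its own circle.
  rw [h0] at him hre
  have hv2 := hv.2
  have ha2 := ha.2
  have hb2 := hb.2
  unfold circlePower at hv2 ha2 hb2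
  have hvre : v.re = (1 - s) * a.re + s * b.re := by linarith
  have hvim : v.im = (1 - s) * a.im + s * b.im := by linarith
  rw [hvre, hvim] at hv2
  have hprod : s * (1 - s) * ((b.re - a.re) ^ 2 + (b.im - a.im) ^ 2) = 0 := by
    linear_combination (1 - s) * ha2 + s * hb2 - hv2
  have hsum : (b.re - a.re) ^ 2 + (b.im - a.im) ^ 2 = 0 := by
    rcases mul_eq_zero.mp hprod with h | h
    · exact absurd h (mul_pos hs0 (by linarith)).ne'
    · exact h
  have e1 : b.re - a.re = 0 := by nlinarith [sq_nonneg (b.re - a.re), sq_nonneg (b.im - a.im)]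
  have e2 : b.im - a.im = 0 := by nlinarith [sq_nonneg (b.re - a.re), sq_nonneg (b.im - a.im)]
  have : (b.re + t * b.im) - (a.re + t * a.im) = 0 := by linear_combination e1 + t * e2
  linarith

/-- Two empty circles with a common middle vertex, on the same side of their chords, coincide. -/
theorem IsMiddleVertex.unique {P : Finset ℂ} {t : ℝ} {c₁ c₂ v : ℂ} {R₁ R₂ τ₁ τ₂ : ℝ}
    (h₁ : IsMiddleVertex P t c₁ R₁ v τ₁) (h₂ : IsMiddleVertex P t c₂ R₂ v τ₂)
    (he₁ : ∀ p ∈ P, 0 ≤ circlePower c₁ R₁ p) (he₂ : ∀ p ∈ P, 0 ≤ circlePower c₂ R₂ p)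
    (hτ : 0 < τ₁ * τ₂) : c₁ = c₂ ∧ R₁ = R₂ := by
  obtain ⟨hv₁, a₁, ha₁, b₁, hb₁, s₁, hpa₁, hpb₁, hs₁, hs₁', hlt₁, hre₁, him₁⟩ := h₁
  obtain ⟨hv₂, a₂, ha₂, b₂, hb₂, s₂, hpa₂, hpb₂, hs₂, hs₂', hlt₂, hre₂, him₂⟩ := h₂
  set x := c₁.re - c₂.re with hx
  set y := c₁.im - c₂.im with hy
  -- The difference of the powers is affine and vanishes at v. Emptiness makes it ≤ 0 at the first
  -- chord point and ≥ 0 at the second; these lie on one ray from v, so it vanishes along that ray.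
  have hdiff : ∀ p, circlePower c₁ R₁ p - circlePower c₂ R₂ p
      = -2 * ((p.re - v.re) * x + (p.im - v.im) * y) := by
    intro p
    unfold circlePower at *
    linear_combination hv₁ - hv₂
  have A₁ := hdiff a₁
  have B₁ := hdiff b₁
  have A₂ := hdiff a₂
  have B₂ := hdiff b₂
  have hA₁ := he₂ a₁ ha₁
  have hB₁ := he₂ b₁ hb₁
  have hA₂ := he₁ a₂ ha₂
  have hB₂ := he₁ b₂ hb₂
  rw [hpa₁] at A₁
  rw [hpb₁] at B₁
  rw [hpa₂] at A₂
  rw [hpb₂] at B₂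
  have e₁ : (1 - s₁) * circlePower c₂ R₂ a₁ + s₁ * circlePower c₂ R₂ b₁ = 2 * (τ₁ * (y - t * x)) := by
    linear_combination (-(1 - s₁)) * A₁ - s₁ * B₁ + 2 * x * hre₁ + 2 * y * him₁
  have e₂ : (1 - s₂) * circlePower c₁ R₁ a₂ + s₂ * circlePower c₁ R₁ b₂ = -2 * (τ₂ * (y - t * x)) := by
    linear_combination (1 - s₂) * A₂ + s₂ * B₂ - 2 * x * hre₂ - 2 * y * him₂
  have m1 : 0 ≤ (1 - s₁) * circlePower c₂ R₂ a₁ := mul_nonneg (by linarith) hA₁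
  have m2 : 0 ≤ s₁ * circlePower c₂ R₂ b₁ := mul_nonneg hs₁.le hB₁
  have m3 : 0 ≤ (1 - s₂) * circlePower c₁ R₁ a₂ := mul_nonneg (by linarith) hA₂
  have m4 : 0 ≤ s₂ * circlePower c₁ R₁ b₂ := mul_nonneg hs₂.le hB₂
  have n1 : 0 ≤ τ₁ * (y - t * x) := by linarith
  have n2 : τ₂ * (y - t * x) ≤ 0 := by linarith
  have hyt : y - t * x = 0 := by
    by_contra hne
    have : 0 < (τ₁ * τ₂) * (y - t * x) ^ 2 := by positivity
    nlinarith [mul_nonneg n1 (neg_nonneg.mpr n2)]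
  rw [hyt, mul_zero, mul_zero] at e₁
  have hz : (1 - s₁) * circlePower c₂ R₂ a₁ = 0 := by linarith
  have hz' : circlePower c₂ R₂ a₁ = 0 :=
    (mul_eq_zero.mp hz).resolve_left (by linarith)
  rw [hz'] at A₁
  -- It vanishes at a₁ too, which is off the line through v in the kernel direction; hence it is
  -- identically zero.
  have hprod : ((v.re + t * v.im) - (a₁.re + t * a₁.im)) * x = 0 := by
    linear_combination -A₁ / 2 + (a₁.im - v.im) * hyt
  have hx0 : x = 0 := (mul_eq_zero.mp hprod).resolve_left (by linarith)
  have hy0 : y = 0 := by rw [hx0] at hyt; linarith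
  have hc : c₁ = c₂ := Complex.ext (by linarith) (by linarith)
  refine ⟨hc, ?_⟩
  subst hc
  unfold circlePower at hv₁ hv₂
  linarith

theorem IsMiddleVertex.exists_lt {P : Finset ℂ} {t : ℝ} {c v : ℂ} {R τ : ℝ}
    (h : IsMiddleVertex P t c R v τ) : ∃ a ∈ P, a.re + t * a.im < v.re + t * v.im := by
  obtain ⟨-, a, ha, -, -, -, -, -, -, -, hlt, -⟩ := h
  exact ⟨a, ha, hlt⟩

/-! ### Counting -/

theorem mainTheorem5 (good bad : Set ℂ) (hdisj : Disjoint good bad) (g b : ℕ) (hg_pos : 0 < g)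
    (hg : (good ∩ Metric.ball 0 1).encard = g)
    (hb : (bad ∩ Metric.ball 0 3).encard = b) :
    ∃ (c : ℂ) (r : ℝ), 0 < r ∧
      (g : ℝ≥0∞) / (2 * (b : ℝ≥0∞) + 12) < ((good ∩ Metric.ball c r).encard : ℝ≥0∞) ∧
      bad ∩ Metric.ball c r = ∅ := by
  classical
  have hgfin := Set.finite_of_encard_eq_coe hg
  have hbfin := Set.finite_of_encard_eq_coe hb
  set G := hgfin.toFinset with hG
  set B := hbfin.toFinset with hB
  have hGcard : G.card = g := by
    rw [hgfin.encard_eq_coe_toFinset_card] at hg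
    exact_mod_cast hg
  have hBcard : B.card = b := by
    rw [hbfin.encard_eq_coe_toFinset_card] at hb
    exact_mod_cast hb
  set P := B ∪ hexagon with hP
  have hhex : hexagon ⊆ P := Finset.subset_union_right
  have hPcard : P.card ≤ b + 6 :=
    (Finset.card_union_le _ _).trans (by rw [hBcard]; exact Nat.add_le_add_left Finset.card_le_six _)
  obtain ⟨t, ht⟩ := exists_injOn_re_add_mul_im P
  have hPne : P.Nonempty := Finset.Nonempty.mono hhex ⟨⟨√3, 0⟩, by simp [hexagon]⟩
  obtain ⟨m, hmP, hmin⟩ := P.exists_min_image (fun z : ℂ => z.re + t * z.im) hPne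
  have hdata : ∀ z ∈ G, ∃ d : ℂ × ℝ × ℂ × ℝ, circlePower d.1 d.2.1 z < 0 ∧
      (∀ p ∈ P, 0 ≤ circlePower d.1 d.2.1 p) ∧ d.2.2.1 ∈ P ∧ d.2.2.2 ≠ 0 ∧
      IsMiddleVertex P t d.1 d.2.1 d.2.2.1 d.2.2.2 := by
    intro z hz
    have hz' : z ∈ good ∩ Metric.ball 0 1 := hgfin.mem_toFinset.mp hz
    have hz1 : ‖z‖ < 1 := by simpa using hz'.2
    have hzP : z ∉ P := by
      rw [hP, Finset.mem_union, not_or]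
      refine ⟨fun h => ?_, fun h => ?_⟩
      · exact Set.disjoint_left.mp hdisj hz'.1 (hbfin.mem_toFinset.mp h).1
      · have h3 := normSq_of_mem_hexagon h
        have : ‖z‖ ^ 2 = 3 := by
          rw [Complex.sq_norm, Complex.normSq_apply]; linarith
        nlinarith [norm_nonneg z]
    obtain ⟨c, R, h1, h2, h3⟩ := exists_empty_circumdisc hhex hz1 hzP
    obtain ⟨v, hv, τ, hτ, hmid⟩ := exists_isMiddleVertex ht h3
    exact ⟨(c, R, v, τ), h1, h2, hv, hτ, hmid⟩
  choose! d hd1 hd2 hd3 hd4 hd5 using hdata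
  let T : Finset (ℂ × Bool) := P.erase m ×ˢ Finset.univ
  -- Erasing the minimum m saves two labels, which makes the final inequality strict.
  have hTcard : T.card + 2 ≤ 2 * b + 12 := by
    have : (P.erase m).card + 1 = P.card := Finset.card_erase_add_one hmP
    simp only [T, Finset.card_product, Finset.card_univ, Fintype.card_bool]
    omega
  have hmaps : ∀ z ∈ G, ((d z).2.2.1, decide (0 < (d z).2.2.2)) ∈ T := by
    intro z hz
    simp only [T, Finset.mem_product, Finset.mem_erase, Finset.mem_univ, and_true]
    refine ⟨fun h => ?_, hd3 z hz⟩
    obtain ⟨a, ha, hlt⟩ := (hd5 z hz).exists_lt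
    rw [h] at hlt
    exact absurd (hmin a ha) (not_le.mpr hlt)
  obtain ⟨k, -, hk⟩ : ∃ k ∈ T, g < (2 * b + 12) *
      {z ∈ G | ((d z).2.2.1, decide (0 < (d z).2.2.2)) = k}.card := by
    by_contra! hcon
    have hsum := Finset.card_eq_sum_card_fiberwise hmaps
    have h1 : (2 * b + 12) * g ≤ T.card * g := by
      rw [← hGcard, hsum, Finset.mul_sum, ← hsum, hGcard, ← smul_eq_mul]
      exact Finset.sum_le_card_nsmul _ _ _ hcon
    have := Nat.le_of_mul_le_mul_right h1 hg_pos
    omega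
  set F := {z ∈ G | ((d z).2.2.1, decide (0 < (d z).2.2.2)) = k} with hF
  obtain ⟨z₀, hz₀⟩ : F.Nonempty := by
    rw [← Finset.card_pos]
    exact Nat.pos_of_ne_zero fun h => by simp [h] at hk
  have hz₀' := Finset.mem_filter.mp hz₀
  have hz₀G := hz₀'.1
  set c := (d z₀).1 with hc
  set R := (d z₀).2.1 with hR
  have hz₀n : ‖z₀‖ < 1 := by simpa using (hgfin.mem_toFinset.mp hz₀G).2
  obtain ⟨-, -, hcR⟩ := circle_bounds_of_hexagon (fun p hp => hd2 z₀ hz₀G p (hhex hp)) hz₀n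
    (hd1 z₀ hz₀G).le
  have hz₀ball : z₀ ∈ Metric.ball c (√R) := (mem_ball_sqrt_iff _ _ _).mpr (hd1 z₀ hz₀G)
  refine ⟨c, √R, Metric.pos_of_mem_ball hz₀ball, ?_, ?_⟩
  · have hsub : (F : Set ℂ) ⊆ good ∩ Metric.ball c (√R) := by
      intro z hz
      obtain ⟨hzG, hzk⟩ := Finset.mem_filter.mp (Finset.mem_coe.mp hz)
      refine ⟨(hgfin.mem_toFinset.mp hzG).1, (mem_ball_sqrt_iff _ _ _).mpr ?_⟩
      have hkk := hzk.trans hz₀'.2.symm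
      rw [Prod.mk.injEq, decide_eq_decide] at hkk
      have hsign : 0 < (d z).2.2.2 * (d z₀).2.2.2 := by
        rcases lt_or_gt_of_ne (hd4 z hzG) with h | h
        · exact mul_pos_of_neg_of_neg h
            (lt_of_le_of_ne (not_lt.mp fun h' => lt_asymm h (hkk.2.mpr h')) (hd4 z₀ hz₀G))
        · exact mul_pos h (hkk.2.mp h)
      have hmid := hd5 z hzG
      rw [hkk.1] at hmid
      obtain ⟨e1, e2⟩ := hmid.unique (hd5 z₀ hz₀G) (hd2 z hzG) (hd2 z₀ hz₀G) hsign
      rw [hc, hR, ← e1, ← e2]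
      exact hd1 z hzG
    have hle : ((F.card : ℕ∞) : ℝ≥0∞) ≤ ((good ∩ Metric.ball c (√R)).encard : ℝ≥0∞) := by
      rw [ENat.toENNReal_le, ← Set.encard_coe_eq_coe_finsetCard]
      exact Set.encard_le_encard hsub
    refine lt_of_lt_of_le ?_ hle
    rw [ENat.toENNReal_coe]
    apply ENNReal.div_lt_of_lt_mul'
    exact_mod_cast hk
  · rw [Set.eq_empty_iff_forall_notMem]
    rintro p ⟨hpbad, hpball⟩
    have hp3 : p ∈ Metric.ball (0 : ℂ) 3 := by
      rw [mem_ball_zero_iff]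
      have h1 : dist p c < √R := hpball
      have h2 := norm_le_norm_add_norm_sub' p c
      rw [← dist_eq_norm] at h2
      linarith
    have hpP : p ∈ P := Finset.mem_union_left _ (hbfin.mem_toFinset.mpr ⟨hpbad, hp3⟩)
    exact absurd ((mem_ball_sqrt_iff _ _ _).mp hpball) (not_lt.mpr (hd2 z₀ hz₀G p hpP))
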